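/- All graphs are finite, simple and undirected. A connected graph $G$ with chromatic number $k$ is called double-critical if, for every edge $uv$ of $G$, the graph $G-u-v$ is $(k-2)$-colourable. For a vertex $x$ of $G$, let $G_x := G[N(x)]$ denote the subgraph of $G$ induced by the set $N(x)$ of neighbours of $x$. Let $K_8^-$ denote the complete graph on $8$ vertices with one edge removed. A graph $H$ is a minor of $G$ if there are non-empty, pairwise disjoint sets $V_h\subseteq V(G)$, $h\in V(H)$, such that each induced subgraph $G[V_h]$ is connected and, for any two adjacent vertices $h_1,h_2$ of $H$, some vertex of $V_{h_1}$ is adjacent in $G$ to some vertex of $V_{h_2}$. Proposition. Suppose $G$ is a double-critical graph with chromatic number $8$ and minimum degree $10$. If $G$ contains a vertex $x$ of degree $10$ such that $G_x$ contains at least one vertex of degree $9$ in $G_x$, then $G$ contains a $K_8^-$ minor. -/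

import Mathlib

namespace SimpleGraph

/-- A connected `k`-chromatic graph `G` is double-critical if for every edge `uv` of `G`
the graph `G - u - v` is `(k - 2)`-colourable. (If `G` has an edge then `k ≥ 2`, so the
subtraction is never truncated.) -/
structure IsDoubleCritical {V : Type*} (G : SimpleGraph V) (k : ℕ) : Prop where
  connected : G.Connected
  chromaticNumber_eq : G.chromaticNumber = (k : ℕ∞)
  colorable_of_adj : ∀ u v : V, G.Adj u v →
    (G.induce (({u, v} : Set V)ᶜ)).Colorable (k - 2)

/-- The neighbourhood graph `G_x = G[N(x)]`. -/
abbrev neighborhoodGraph {V : Type*} (G : SimpleGraph V) (x : V) :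
    SimpleGraph (G.neighborSet x) :=
  G.induce (G.neighborSet x)

/-- `H.IsMinor G`: the graph `H` is a minor of `G`, through non-empty, pairwise disjoint,
connected branch sets. -/
def IsMinor {W V : Type*} (H : SimpleGraph W) (G : SimpleGraph V) : Prop :=
  ∃ B : W → Set V,
    (∀ h, (B h).Nonempty) ∧
    (∀ h₁ h₂, h₁ ≠ h₂ → Disjoint (B h₁) (B h₂)) ∧
    (∀ h, (G.induce (B h)).Connected) ∧
    (∀ h₁ h₂, H.Adj h₁ h₂ → ∃ a ∈ B h₁, ∃ b ∈ B h₂, G.Adj a b)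

/-- `K_8^-`: the complete graph on eight vertices with one edge removed. -/
def K8Minus : SimpleGraph (Fin 8) :=
  (completeGraph (Fin 8)).deleteEdges {s(0, 1)}

end SimpleGraph

/-! In a double-critical 8-chromatic graph, adjacent vertices have at least six common neighbours,
since otherwise a 6-colouring of the graph minus both ends could be turned into a 7-colouring of the
whole (`exists_common_neighbor`). Let v be the vertex of degree 9 in N(x); it is adjacent to all the
rest of N(x). Deleting v leaves a graph H on nine vertices of minimum degree at least five. If H has
a K_6^- minor (or K_6), then the singletons {v} and {x} extend it to the required minor.

That H has such a minor is `hasAlmostCompleteMinor_six`. The complement of H has maximum degree at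
most three; enlarge it to an edge-maximal such graph C. By parity some vertex o has degree below
three, and by maximality all such vertices are pairwise adjacent. An exhaustive kernel-evaluated
search over these C finds six branch sets in the complement of C, three singletons and three pairs;
the complement of C is a subgraph of H. -/

namespace SimpleGraph

/-! ### The exhaustive search -/

/-- Lookup in a lower triangular table of Booleans. -/
def lookup : List (List Bool) → ℕ → ℕ → Bool
  | [], _, _ => false
  | _ :: _, 0, 0 => false
  | r :: _, 0, j + 1 => r.getD j false
  | r :: _, i + 1, 0 => r.getD i false
  | _ :: R, i + 1, j + 1 => lookup R i j

/-- All but at most one member of the list satisfy `p`. -/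
def allButOne {α : Type*} (p : α → Bool) : List α → Bool
  | [] => true
  | a :: l => bif p a then allButOne p l else l.all p

/-- All pairs formed by an entry of a list and a later entry. -/
def laterPairs {α : Type*} : List α → List (α × α)
  | [] => []
  | a :: l => l.map (Prod.mk a) ++ laterPairs l

/-- Some index of the first part and some index of the second part are not adjacent in the graph
with table `R`. -/
def joined (R : List (List Bool)) (e : (ℕ × ℕ) × (ℕ × ℕ)) : Bool :=
  !(lookup R e.1.1 e.2.1 && lookup R e.1.1 e.2.2 && lookup R e.1.2 e.2.1 && lookup R e.1.2 e.2.2)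

/-- The two parts have no index in common. -/
def apart (e : (ℕ × ℕ) × (ℕ × ℕ)) : Bool :=
  !(e.1.1.beq e.2.1 || e.1.1.beq e.2.2 || e.1.2.beq e.2.1 || e.1.2.beq e.2.2)

/-- The six parts `P` form a model of the complete graph on six vertices with at most one edge
removed, in the complement of the graph with table `R`. -/
def isModel (R : List (List Bool)) (P : List (ℕ × ℕ)) : Bool :=
  P.all (fun A => !lookup R A.1 A.2) && allButOne (joined R) (laterPairs P) &&
    (P.length.beq 6 && P.all (fun A => A.1.blt 9 && A.2.blt 9) && (laterPairs P).all apart)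

/-- All ways to pick an entry of a list, with the remaining entries. -/
def picks {α : Type*} : List α → List (α × List α)
  | [] => []
  | a :: l => (a, l) :: (picks l).map fun q => (q.1, a :: q.2)

/-- All ways to split a list into pairs (for a list of length at most `2 * n`). -/
def pairings : ℕ → List ℕ → List (List (ℕ × ℕ))
  | n + 1, a :: l => (picks l).flatMap fun q => (pairings n q.2).map ((a, q.1) :: ·)
  | _, _ => [[]]

/-- All ways to split a list into `k` singletons and at most `n` pairs. -/
def partitions (n : ℕ) : ℕ → List ℕ → List ℕ → List (List (ℕ × ℕ))
  | 0, kept, l => pairings n (kept ++ l)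
  | _ + 1, _, [] => []
  | k + 1, kept, a :: l =>
    (partitions n k kept l).map (fun P => P ++ [(a, a)]) ++ partitions n (k + 1) (kept ++ [a]) l

/-- Rows with at most `j` entries `true`, all of them at positions where `D` is below `3`. -/
def rows : List ℕ → ℕ → List (List Bool)
  | [], _ => [[]]
  | _ :: D, 0 => (rows D 0).map (List.cons false)
  | d :: D, j + 1 => (rows D (j + 1)).map (List.cons false) ++
      bif d.blt 3 then (rows D j).map (List.cons true) else []

/-- Breadth first generation of the graphs on nine vertices of maximum degree at most three,
newest vertex first, with a test of `isModel` for each of them. Here `k` is the number of vertices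
that may have undiscovered neighbours, `R` the adjacency table and `D` the list of degrees, where
the degree of the oldest vertex is increased by one. Every other vertex is required to have degree
three or to be adjacent to the oldest vertex. -/
def search : ℕ → ℕ → List (List Bool) → List ℕ → Bool
  -- Running out of fuel counts as failure, so soundness needs no termination bound.
  | 0, _, _, _ => false
  | n + 1, 0, R, D =>
    bif R.length.beq 9 then
      (partitions 3 3 [] (8 :: List.range 8)).any (isModel R)
    -- Every known vertex is closed, so the next one opens a new component.
    else search n 1 (List.replicate R.length false :: R) (0 :: D)
  | n + 1, k + 1, R, D =>
    (bif (D.getD k 0).beq 3 || R.length.beq (k + 1) || lookup R k (R.length - 1) then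
      search n k R D else true) &&
    (bif (D.getD k 0).blt 3 && !R.length.beq 9 then
      -- A new neighbour of vertex `k` has at most two others, all among the `k` newer open
      -- vertices; the older vertices are closed.
      ((rows (D.take k) 2).map
        (· ++ true :: List.replicate (R.length - (k + 1)) false)).all fun r =>
          search n (k + 2) (r :: R) (r.count true :: List.zipWith (fun b d => b.toNat + d) r D)
      else true)

/-- The start is the single vertex o; its initial degree 1 lets the uniform cap of three enforce a
true degree of at most two. A branch takes at most eight discoveries, nine closings and one test, so
fuel 20 suffices. -/
theorem search_eq_true : search 20 1 [[]] [1] = true := by decide +kernel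

/-! ### From tables to minors -/

variable {V : Type*}

/-- The adjacency table of a list of vertices. -/
def table (C : SimpleGraph V) [DecidableRel C.Adj] : List V → List (List Bool)
  | [] => []
  | w :: vs => vs.map (fun v => decide (C.Adj w v)) :: table C vs

theorem length_table (C : SimpleGraph V) [DecidableRel C.Adj] (vs : List V) :
    (table C vs).length = vs.length := by
  induction vs with
  | nil => rfl
  | cons w vs ih => simp [table, ih]

theorem lookup_table (C : SimpleGraph V) [DecidableRel C.Adj] (vs : List V) (i j : ℕ)
    (hi : i < vs.length) (hj : j < vs.length) :
    lookup (table C vs) i j = decide (C.Adj vs[i] vs[j]) := by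
  induction vs generalizing i j with
  | nil => simp at hi
  | cons w vs ih =>
    rcases i with _ | i <;> rcases j with _ | j
    · simp [table, lookup]
    · simp at hj
      simp [table, lookup, hj]
    · simp at hi
      simp [table, lookup, hi, C.adj_comm]
    · simp at hi hj
      simpa [table, lookup] using ih i j hi hj

theorem exists_of_allButOne {α : Type*} {p : α → Bool} {l : List α} (h : allButOne p l = true)
    (hl : l ≠ []) : ∃ a ∈ l, ∀ b ∈ l, b = a ∨ p b = true := by
  induction l with
  | nil => exact absurd rfl hl
  | cons a l ih =>
    by_cases ha : p a = true
    · simp only [allButOne, ha, cond_true] at h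
      by_cases hl' : l = []
      · exact ⟨a, by simp, by simp [hl']⟩
      · obtain ⟨c, hc, hcl⟩ := ih h hl'
        refine ⟨c, by simp [hc], fun b hb => ?_⟩
        rcases List.mem_cons.1 hb with rfl | hb
        · exact Or.inr ha
        · exact hcl b hb
    · simp only [allButOne, ha, cond_false, List.all_eq_true] at h
      refine ⟨a, by simp, fun b hb => ?_⟩
      rcases List.mem_cons.1 hb with rfl | hb
      · exact Or.inl rfl
      · exact Or.inr (h b hb)

theorem mem_laterPairs {α : Type*} (l : List α) (i j : ℕ) (hij : i < j) (hj : j < l.length) :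
    (l[i], l[j]) ∈ laterPairs l := by
  induction l generalizing i j with
  | nil => simp at hj
  | cons a l ih =>
    obtain _ | j := j
    · omega
    simp at hj
    rcases i with _ | i
    · simp [laterPairs]
    · simp only [laterPairs, List.mem_append]
      exact Or.inr (ih i j (by omega) hj)

theorem exists_of_mem_laterPairs {α : Type*} (l : List α) (e : α × α) (he : e ∈ laterPairs l) :
    ∃ i j, ∃ (hij : i < j) (hj : j < l.length), e = (l[i], l[j]) := by
  induction l with
  | nil => simp [laterPairs] at he
  | cons a l ih =>
    simp only [laterPairs, List.mem_append, List.mem_map] at he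
    rcases he with ⟨b, hb, rfl⟩ | he
    · obtain ⟨j, hj, rfl⟩ := List.getElem_of_mem hb
      exact ⟨0, j + 1, by omega, by simpa using hj, by simp⟩
    · obtain ⟨i, j, hij, hj, rfl⟩ := ih he
      exact ⟨i + 1, j + 1, by omega, by simpa using hj, by simp⟩

/-- `G` has a minor that is a complete graph on `n` vertices with at most one edge removed. -/
def HasAlmostCompleteMinor (G : SimpleGraph V) (n : ℕ) : Prop :=
  ∃ (B : Fin n → Set V) (a b : Fin n), a ≠ b ∧
    (∀ i, (B i).Nonempty) ∧
    (∀ i j, i ≠ j → Disjoint (B i) (B j)) ∧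
    (∀ i, (G.induce (B i)).Connected) ∧
    (∀ i j, i ≠ j → s(i, j) ≠ s(a, b) → ∃ u ∈ B i, ∃ w ∈ B j, G.Adj u w)

/-- Equality is allowed because a singleton branch set is stored as a pair with equal entries. -/
theorem connected_induce_pair {G : SimpleGraph V} {u w : V} (h : u = w ∨ G.Adj u w) :
    (G.induce ({u, w} : Set V)).Connected := by
  rcases h with rfl | h
  · rw [Set.pair_eq_singleton]
    exact Connected.of_subsingleton
  · exact induce_pair_connected_of_adj h

theorem hasAlmostCompleteMinor_of_isModel (C : SimpleGraph V) [DecidableRel C.Adj] {vs : List V}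
    (hvs : vs.Nodup) (hlen : vs.length = 9) {P : List (ℕ × ℕ)}
    (hP : isModel (table C vs) P = true) : Cᶜ.HasAlmostCompleteMinor 6 := by
  simp only [isModel, Bool.and_eq_true, List.all_eq_true, Nat.beq_eq] at hP
  obtain ⟨⟨hconn, hjoin⟩, ⟨h6, hlt⟩, hapart⟩ := hP
  have hlt' : ∀ i (hi : i < P.length), P[i].1 < vs.length ∧ P[i].2 < vs.length := by
    intro i hi
    have := hlt P[i] (List.getElem_mem hi)
    simp only [Nat.blt_eq] at this
    omega
  have hinj : ∀ (i j : ℕ) (hi : i < vs.length) (hj : j < vs.length), vs[i] = vs[j] ↔ i = j :=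
    fun i j hi hj => hvs.getElem_inj_iff
  have hdis : ∀ i j (hij : i < j) (hj : j < P.length), P[i].1 ≠ P[j].1 ∧ P[i].1 ≠ P[j].2 ∧
      P[i].2 ≠ P[j].1 ∧ P[i].2 ≠ P[j].2 := by
    intro i j hij hj
    have := hapart _ (mem_laterPairs P i j hij hj)
    simpa [apart, and_assoc, ← Bool.not_eq_true, Nat.beq_eq] using this
  have hget : ∀ i j (hi : i < P.length) (hj : j < P.length), P[i] = P[j] → i = j := by
    intro i j hi hj h
    rcases lt_trichotomy i j with hij | hij | hij
    · exact absurd (congrArg Prod.fst h) (hdis i j hij hj).1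
    · exact hij
    · exact absurd (congrArg Prod.fst h) (hdis j i hij hi).1.symm
  obtain ⟨e, he, hall⟩ := exists_of_allButOne hjoin
    (List.ne_nil_of_mem (mem_laterPairs P 0 1 (by omega) (by omega)))
  obtain ⟨a, b, hab, hb, rfl⟩ := exists_of_mem_laterPairs P e he
  have hadj : ∀ i j (hij : i < j) (hj : j < P.length), ¬ (i = a ∧ j = b) →
      ∃ u ∈ ({vs[P[i].1]'(hlt' i (by omega)).1, vs[P[i].2]'(hlt' i (by omega)).2} : Set V),
      ∃ w ∈ ({vs[P[j].1]'(hlt' j hj).1, vs[P[j].2]'(hlt' j hj).2} : Set V), Cᶜ.Adj u w := by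
    intro i j hij hj hne
    have hd := hdis i j hij hj
    have h1 := hlt' i (by omega)
    have h2 := hlt' j hj
    rcases hall _ (mem_laterPairs P i j hij hj) with h | h
    · obtain ⟨hia, hjb⟩ := Prod.mk.inj h
      exact absurd ⟨hget i a (by omega) (by omega) hia, hget j b hj hb hjb⟩ hne
    · simp only [joined] at h
      rw [lookup_table C vs _ _ h1.1 h2.1, lookup_table C vs _ _ h1.1 h2.2,
        lookup_table C vs _ _ h1.2 h2.1, lookup_table C vs _ _ h1.2 h2.2] at h
      by_contra hcon
      push Not at hcon
      simp only [compl_adj, not_and, not_not, ne_eq, Set.mem_insert_iff, Set.mem_singleton_iff,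
        forall_eq_or_imp, forall_eq, hinj] at hcon
      simp [hcon.1.1 hd.1, hcon.1.2 hd.2.1, hcon.2.1 hd.2.2.1, hcon.2.2 hd.2.2.2] at h
  have hi6 : ∀ i : Fin 6, (i : ℕ) < P.length := fun i => by omega
  refine ⟨fun i => {vs[P[(i : ℕ)].1]'(hlt' i (hi6 i)).1, vs[P[(i : ℕ)].2]'(hlt' i (hi6 i)).2},
    ⟨a, by omega⟩, ⟨b, by omega⟩, by simp [hab.ne], fun i => Set.insert_nonempty _ _, ?_, ?_, ?_⟩
  · have key : ∀ i j : Fin 6, i < j →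
        Disjoint ({vs[P[(i : ℕ)].1]'(hlt' i (hi6 i)).1, vs[P[(i : ℕ)].2]'(hlt' i (hi6 i)).2} : Set V)
          {vs[P[(j : ℕ)].1]'(hlt' j (hi6 j)).1, vs[P[(j : ℕ)].2]'(hlt' j (hi6 j)).2} := by
      intro i j hij
      have hd := hdis i j hij (hi6 j)
      simp [hinj, hd.1.symm, hd.2.1.symm, hd.2.2.1.symm, hd.2.2.2.symm]
    intro i j hij
    rcases lt_or_gt_of_ne hij with h | h
    · exact key i j h
    · exact (key j i h).symm
  · intro i
    refine connected_induce_pair ?_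
    have h := hconn _ (List.getElem_mem (hi6 i))
    rw [lookup_table C vs _ _ (hlt' i (hi6 i)).1 (hlt' i (hi6 i)).2] at h
    simp only [compl_adj]
    by_cases hu : vs[P[(i : ℕ)].1]'(hlt' i (hi6 i)).1 = vs[P[(i : ℕ)].2]'(hlt' i (hi6 i)).2
    · exact Or.inl hu
    · exact Or.inr ⟨hu, by simpa using h⟩
  · intro i j hij hne
    rcases lt_or_gt_of_ne hij with h | h
    · refine hadj i j h (hi6 j) ?_
      rintro ⟨rfl, rfl⟩
      exact hne rfl
    · obtain ⟨u, hu, w, hw, huw⟩ := hadj j i h (hi6 i) (by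
        rintro ⟨rfl, rfl⟩
        exact hne Sym2.eq_swap)
      exact ⟨w, hw, u, hu, huw.symm⟩

/-! ### Correctness of the search -/

theorem mem_rows {D : List ℕ} {j : ℕ} {r : List Bool} (hlen : r.length = D.length)
    (hcount : r.count true ≤ j)
    (hlt : ∀ i (hi : i < r.length), r[i] = true → D[i] < 3) : r ∈ rows D j := by
  induction D generalizing j r with
  | nil => simpa [rows] using hlen
  | cons d D ih =>
    obtain _ | ⟨b, r⟩ := r
    · simp at hlen
    have hlt' : ∀ i (hi : i < r.length), r[i] = true → D[i]'(by simp at hlen; omega) < 3 := by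
      intro i hi hr
      simpa using hlt (i + 1) (by simpa using hi) (by simpa using hr)
    have hd : b = true → d < 3 := fun hb => by simpa using hlt 0 (by simp) (by simpa using hb)
    have hlen' : r.length = D.length := by simpa using hlen
    cases b
    · have := ih hlen' (j := j) (by simpa using hcount) hlt'
      cases j <;> simp [rows, this]
    · obtain _ | j := j
      · simp at hcount
      have := ih hlen' (j := j) (by simpa using hcount) hlt'
      have h3 : d.blt 3 = true := by simpa [Nat.blt_eq] using hd rfl
      simp [rows, h3, this]

/-- The number of neighbours of `v` in the list `vs`, plus one if `v = o`. -/
def listDegree (C : SimpleGraph V) [DecidableRel C.Adj] [DecidableEq V] (o : V) (vs : List V)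
    (v : V) : ℕ :=
  vs.countP (fun w => C.Adj v w) + if v = o then 1 else 0

theorem listDegree_cons (C : SimpleGraph V) [DecidableRel C.Adj] [DecidableEq V] (o w : V)
    (vs : List V) (v : V) : listDegree C o (w :: vs) v =
      (decide (C.Adj w v)).toNat + listDegree C o vs v := by
  by_cases h : C.Adj w v <;> simp [listDegree, h, C.adj_comm v w]; omega

theorem listDegree_le [Fintype V] (C : SimpleGraph V) [DecidableRel C.Adj] [DecidableEq V] (o : V)
    {vs : List V} (hvs : vs.Nodup) (v : V) :
    listDegree C o vs v ≤ C.degree v + if v = o then 1 else 0 := by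
  unfold listDegree
  gcongr
  rw [List.countP_eq_length_filter, ← List.toFinset_card_of_nodup (hvs.filter _),
    ← card_neighborFinset_eq_degree]
  exact Finset.card_le_card fun w => by simp

theorem listDegree_lt [Fintype V] (C : SimpleGraph V) [DecidableRel C.Adj] [DecidableEq V] (o : V)
    {vs : List V} (hvs : vs.Nodup) {v w : V} (hw : w ∉ vs) (hvw : C.Adj v w) :
    listDegree C o vs v < C.degree v + if v = o then 1 else 0 := by
  have := listDegree_le C o (List.nodup_cons.2 ⟨hw, hvs⟩) v
  rw [listDegree_cons] at this
  simp [hvw.symm] at this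
  omega

theorem listDegree_eq [Fintype V] (C : SimpleGraph V) [DecidableRel C.Adj] [DecidableEq V] (o : V)
    {vs : List V} (hvs : vs.Nodup) {v : V} (hv : ∀ w, C.Adj v w → w ∈ vs) :
    listDegree C o vs v = C.degree v + if v = o then 1 else 0 := by
  unfold listDegree
  congr 1
  rw [List.countP_eq_length_filter, ← List.toFinset_card_of_nodup (hvs.filter _),
    ← card_neighborFinset_eq_degree]
  congr 1
  ext w
  simpa using hv w

theorem map_listDegree_cons (C : SimpleGraph V) [DecidableRel C.Adj] [DecidableEq V]
    {o w : V} {vs : List V} (hwo : w ≠ o) :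
    (w :: vs).map (listDegree C o (w :: vs)) =
      (vs.map (fun v => decide (C.Adj w v))).count true ::
        List.zipWith (fun b d => b.toNat + d) (vs.map (fun v => decide (C.Adj w v)))
          (vs.map (listDegree C o vs)) := by
  rw [List.map_cons, List.zipWith_map, List.zipWith_self]
  congr 1
  · rw [listDegree_cons]
    simp [listDegree, hwo, List.count, List.countP_map, Function.comp_def]
  · exact List.map_congr_left fun v _ => listDegree_cons C o w vs v

section

variable [Fintype V] [DecidableEq V]

/-- Induction on the fuel follows the branch that `C` itself dictates: close vertex `k` if all its
neighbours are listed, otherwise list a missing one. The invariant `hclosed` says that vertices from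
position `k` on have no unlisted neighbours. -/
theorem hasAlmostCompleteMinor_of_search (C : SimpleGraph V) [DecidableRel C.Adj]
    (hcard : Fintype.card V = 9) {o : V} (hdeg : ∀ v, C.degree v + (if v = o then 1 else 0) ≤ 3)
    (hdef : ∀ v, v ≠ o → C.degree v = 3 ∨ C.Adj v o) (n k : ℕ) (vs : List V)
    (hvs : vs.Nodup) (ho : vs.getLast? = some o) (hk : k ≤ vs.length)
    (hclosed : ∀ v ∈ vs.drop k, ∀ w, C.Adj v w → w ∈ vs)
    (hsearch : search n k (table C vs) (vs.map (listDegree C o vs)) = true) :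
    Cᶜ.HasAlmostCompleteMinor 6 := by
  have hov : o ∈ vs := List.mem_of_getLast? ho
  induction n generalizing k vs with
  | zero => simp [search] at hsearch
  | succ n ih =>
    have step : ∀ w ∉ vs, (∀ v ∈ vs.drop k, ¬ C.Adj w v) → ∀ k', k' = k + 1 →
        search n k' (vs.map (fun v => decide (C.Adj w v)) :: table C vs)
          ((vs.map (fun v => decide (C.Adj w v))).count true ::
            List.zipWith (fun b d => b.toNat + d) (vs.map (fun v => decide (C.Adj w v)))
              (vs.map (listDegree C o vs))) = true → Cᶜ.HasAlmostCompleteMinor 6 := by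
      rintro w hw hwv _ rfl h
      have hwo : w ≠ o := fun h => hw (h ▸ hov)
      refine ih (k + 1) (w :: vs) (List.nodup_cons.2 ⟨hw, hvs⟩) ?_ (by simpa) ?_ ?_ (by simp [hov])
      · rw [List.getLast?_cons, ho]
        rfl
      · intro v hv u hu
        exact List.mem_cons_of_mem _ (hclosed v (by simpa using hv) u hu)
      · rw [map_listDegree_cons C hwo]
        exact h
    obtain _ | k := k
    · by_cases h9 : vs.length = 9
      · have hb : vs.length.beq 9 = true := Nat.beq_eq ▸ h9
        simp only [search, length_table, hb, cond_true, List.any_eq_true] at hsearch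
        -- `isModel` itself checks disjointness and ranges, so nothing about `partitions` is needed.
        obtain ⟨P, -, hP⟩ := hsearch
        exact hasAlmostCompleteMinor_of_isModel C hvs h9 hP
      · have hb : vs.length.beq 9 = false := by
          rw [← Bool.not_eq_true, Nat.beq_eq]; exact h9
        simp only [search, length_table, hb, cond_false] at hsearch
        obtain ⟨w, hw⟩ : ∃ w, w ∉ vs := by
          by_contra! hall
          apply h9
          rw [← List.toFinset_card_of_nodup hvs, ← hcard, ← Finset.card_univ]
          congr 1
          ext v
          simp [hall v]
        have hnadj : ∀ v ∈ vs, ¬ C.Adj w v := fun v hv h => hw (hclosed v (by simpa) w h.symm)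
        have hrow : vs.map (fun v => decide (C.Adj w v)) = List.replicate vs.length false := by
          rw [List.eq_replicate_iff]
          simpa using hnadj
        refine step w hw (by simpa using hnadj) 1 rfl ?_
        have hzip : List.zipWith (fun b d => b.toNat + d) (List.replicate vs.length false)
            (vs.map (listDegree C o vs)) = vs.map (listDegree C o vs) :=
          List.ext_getElem (by simp) (by simp)
        rw [hrow, hzip, List.count_eq_zero.2 (by simp)]
        exact hsearch
    · have hk' : k < vs.length := hk
      have hdrop : vs.drop k = vs[k] :: vs.drop (k + 1) := List.drop_eq_getElem_cons hk'
      simp only [search, length_table, Bool.and_eq_true] at hsearch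
      have hD : (vs.map (listDegree C o vs)).getD k 0 = listDegree C o vs vs[k] := by
        simp [hk']
      rw [hD] at hsearch
      by_cases hc : ∀ w, C.Adj vs[k] w → w ∈ vs
      · have h1 := hsearch.1
        have hlast : vs[vs.length - 1]'(by omega) = o := by
          rw [List.getLast?_eq_getElem?] at ho
          simpa using List.getElem_of_getElem? ho |>.2
        have hcond : ((listDegree C o vs vs[k]).beq 3 || vs.length.beq (k + 1) ||
            lookup (table C vs) k (vs.length - 1)) = true := by
          rw [lookup_table C vs _ _ hk' (by omega)]
          simp only [Bool.or_eq_true, Nat.beq_eq, decide_eq_true_eq, hlast]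
          by_cases hko : vs[k] = o
          · rw [← hlast, hvs.getElem_inj_iff] at hko
            omega
          · rcases hdef _ hko with h | h
            · left; left
              rw [listDegree_eq C o hvs hc, if_neg hko, h]
            · exact Or.inr h
        rw [hcond, cond_true] at h1
        refine ih k vs hvs ho (by omega) ?_ h1 hov
        rw [hdrop]
        intro v hv
        rcases List.mem_cons.1 hv with rfl | hv
        · exact hc
        · exact hclosed v hv
      · push Not at hc
        obtain ⟨w, hkw, hw⟩ := hc
        have h2 := hsearch.2
        have hlt : ∀ v, C.Adj v w → listDegree C o vs v < 3 := fun v hv =>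
          (listDegree_lt C o hvs hw hv).trans_le (hdeg v)
        have hlen : vs.length ≠ 9 := by
          intro h9
          have : (w :: vs).Nodup := List.nodup_cons.2 ⟨hw, hvs⟩
          have := this.length_le_card
          simp at this
          omega
        have hcond : ((listDegree C o vs vs[k]).blt 3 && !vs.length.beq 9) = true := by
          simp [Nat.blt_eq, hlt _ hkw, ← Bool.not_eq_true, Nat.beq_eq, hlen]
        rw [hcond, cond_true, List.all_eq_true] at h2
        have hnadj : ∀ v ∈ vs.drop (k + 1), ¬ C.Adj w v := fun v hv h =>
          hw (hclosed v hv w h.symm)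
        have hwo : w ≠ o := fun h => hw (h ▸ hov)
        have hrow : vs.map (fun v => decide (C.Adj w v)) =
            (vs.take k).map (fun v => decide (C.Adj w v)) ++
              true :: List.replicate (vs.length - (k + 1)) false := by
          conv_lhs => rw [← List.take_append_drop k vs, hdrop, List.map_append, List.map_cons]
          congr 2
          · simpa using hkw.symm
          · rw [List.eq_replicate_iff]
            refine ⟨by simp, fun b hb => ?_⟩
            obtain ⟨v, hv, rfl⟩ := List.mem_map.1 hb
            simpa using hnadj v hv
        refine step w hw hnadj (k + 2) rfl (h2 _ ?_)
        rw [hrow, List.mem_map]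
        refine ⟨_, mem_rows ?_ ?_ ?_, rfl⟩
        · simp
        · have hle := (listDegree_le C o hvs w).trans (hdeg w)
          have : listDegree C o vs w = (vs.map (fun v => decide (C.Adj w v))).count true := by
            simp [listDegree, hwo, List.count, List.countP_map, Function.comp_def]
          rw [this, hrow] at hle
          rw [List.count_append, List.count_cons_self] at hle
          omega
        · intro i hi h
          simp at hi h
          simpa using hlt _ h.symm

theorem hasAlmostCompleteMinor_compl (C : SimpleGraph V) [DecidableRel C.Adj]
    (hcard : Fintype.card V = 9) {o : V} (hdeg : ∀ v, C.degree v ≤ 3) (ho : C.degree o < 3)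
    (hdef : ∀ v, v ≠ o → C.degree v = 3 ∨ C.Adj v o) : Cᶜ.HasAlmostCompleteMinor 6 := by
  refine hasAlmostCompleteMinor_of_search C hcard (o := o) ?_ hdef 20 1 [o] (by simp) (by simp)
    (by simp) (by simp) ?_
  · intro v
    split_ifs with h
    · subst h; omega
    · exact hdeg v
  · simpa [table, listDegree] using search_eq_true

end

/-! ### Nine vertices, minimum degree five -/

theorem HasAlmostCompleteMinor.mono {G H : SimpleGraph V} {n : ℕ} (h : G ≤ H)
    (hG : G.HasAlmostCompleteMinor n) : H.HasAlmostCompleteMinor n := by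
  obtain ⟨B, a, b, hab, hne, hdis, hconn, hadj⟩ := hG
  refine ⟨B, a, b, hab, hne, hdis, fun i => (hconn i).mono fun u w huw => h huw, ?_⟩
  intro i j hij hs
  obtain ⟨u, hu, w, hw, huw⟩ := hadj i j hij hs
  exact ⟨u, hu, w, hw, h huw⟩

/-- A graph on nine vertices of minimum degree at least five contains, as a minor, the complete
graph on six vertices with at most one edge removed. -/
theorem hasAlmostCompleteMinor_six [Fintype V] [DecidableEq V] (H : SimpleGraph V)
    [DecidableRel H.Adj] (hcard : Fintype.card V = 9) (hdeg : ∀ v, 5 ≤ H.degree v) :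
    H.HasAlmostCompleteMinor 6 := by
  classical
  have hfin : {C : SimpleGraph V | ∀ v, ∀ _ : Fintype (C.neighborSet v), C.degree v ≤ 3}.Finite := Set.toFinite _
  have hmem : Hᶜ ∈ {C : SimpleGraph V | ∀ v, ∀ _ : Fintype (C.neighborSet v), C.degree v ≤ 3} := by
    intro v _
    have := hdeg v
    rw [degree_compl, hcard]
    omega
  obtain ⟨C, hHC, hC⟩ := hfin.exists_le_maximal hmem
  have hC3 : ∀ v, C.degree v ≤ 3 := fun v => hC.prop v _
  -- Otherwise the edge `vw` could be added without exceeding degree three.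
  have hmax : ∀ v w, v ≠ w → C.degree v < 3 → C.degree w < 3 → C.Adj v w := by
    intro v w hvw hv hw
    by_contra hnadj
    have hle : C ≤ C ⊔ edge v w := le_sup_left
    refine hnadj (hC.le_of_ge (y := C ⊔ edge v w) ?_ hle ?_)
    · intro u _
      by_cases hu : u = v ∨ u = w
      · have hsub : (C ⊔ edge v w).neighborFinset u ⊆
            insert (if u = v then w else v) (C.neighborFinset u) := by
          intro z hz
          simp only [mem_neighborFinset, sup_adj, edge_adj, Finset.mem_insert] at hz ⊢
          rcases hz with hz | ⟨⟨rfl, rfl⟩ | ⟨rfl, rfl⟩, -⟩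
          · exact Or.inr hz
          · simp
          · simp [hvw.symm]
        have h1 := Finset.card_le_card hsub
        have h2 := h1.trans (Finset.card_insert_le _ _)
        rw [card_neighborFinset_eq_degree, card_neighborFinset_eq_degree] at h2
        have : C.degree u < 3 := by rcases hu with rfl | rfl <;> assumption
        omega
      · have : (C ⊔ edge v w).neighborFinset u = C.neighborFinset u := by
          ext z
          simp only [mem_neighborFinset, sup_adj, edge_adj]
          tauto
        rw [← card_neighborFinset_eq_degree, this, card_neighborFinset_eq_degree]
        exact hC3 u
    · simp [edge_adj, hvw]
  obtain ⟨o, ho⟩ : ∃ o, C.degree o < 3 := by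
    -- Nine vertices of degree three would have the odd degree sum 27.
    by_contra! h
    have hsum := C.sum_degrees_eq_twice_card_edges
    rw [Finset.sum_congr rfl fun v _ => le_antisymm (hC3 v) (h v), Finset.sum_const,
      Finset.card_univ, hcard, smul_eq_mul] at hsum
    omega
  refine (hasAlmostCompleteMinor_compl C hcard hC3 ho fun v hv => ?_).mono
    (compl_le_iff_compl_le.1 hHC)
  by_cases h : C.degree v < 3
  · exact Or.inr (hmax v o hv h ho)
  · exact Or.inl (le_antisymm (hC3 v) (not_lt.1 h))

/-! ### Extending and relabelling minors -/

/-- A vertex adjacent to all vertices of a subgraph adds one to the order of an almost complete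
minor. -/
theorem HasAlmostCompleteMinor.add_one {W : Type*} {H : SimpleGraph W} {G : SimpleGraph V} {n : ℕ}
    (h : H.HasAlmostCompleteMinor n) (f : H ↪g G) {x : V} (hx : ∀ w, G.Adj x (f w)) :
    G.HasAlmostCompleteMinor (n + 1) := by
  obtain ⟨B, a, b, hab, hne, hdis, hconn, hadj⟩ := h
  have hxB : ∀ i, Disjoint ({x} : Set V) (f '' B i) := by
    intro i
    rw [Set.disjoint_singleton_left]
    rintro ⟨w, -, rfl⟩
    exact (hx w).ne rfl
  have hxadj : ∀ i, ∃ w ∈ f '' B i, G.Adj x w := by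
    intro i
    obtain ⟨w, hw⟩ := hne i
    exact ⟨f w, ⟨w, hw, rfl⟩, hx w⟩
  refine ⟨Fin.cons {x} fun i => f '' B i, a.succ, b.succ, by simpa using hab, ?_, ?_, ?_, ?_⟩
  · refine Fin.cases (by simp) fun i => ?_
    simpa using hne i
  · intro i j
    refine Fin.cases ?_ (fun i => ?_) i <;> refine Fin.cases ?_ (fun j => ?_) j
    · exact fun h => absurd rfl h
    · exact fun _ => hxB j
    · exact fun _ => (hxB i).symm
    · intro hij
      simpa using (Set.disjoint_image_iff f.injective).2 (hdis i j fun h => hij (by rw [h]))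
  · refine Fin.cases ?_ fun i => ?_
    · rw [Fin.cons_zero]
      exact Connected.of_subsingleton
    · rw [Fin.cons_succ]
      refine (hconn i).map (H := G.induce (f '' B i))
        ⟨fun w : B i => ⟨f w, w, w.2, rfl⟩, fun {u w} h => f.map_adj_iff.2 h⟩ ?_
      rintro ⟨_, w, hw, rfl⟩
      exact ⟨⟨w, hw⟩, rfl⟩
  · intro i j
    refine Fin.cases ?_ (fun i => ?_) i <;> refine Fin.cases ?_ (fun j => ?_) j
    · exact fun h => absurd rfl h
    · intro _ _
      obtain ⟨w, hw, h⟩ := hxadj j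
      exact ⟨x, rfl, w, hw, h⟩
    · intro _ _
      obtain ⟨w, hw, h⟩ := hxadj i
      exact ⟨w, hw, x, rfl, h.symm⟩
    · intro hij hs
      obtain ⟨u, hu, w, hw, huw⟩ := hadj i j (fun h => hij (by rw [h])) (by
        simpa [Sym2.eq_iff] using hs)
      exact ⟨f u, ⟨u, hu, rfl⟩, f w, ⟨w, hw, rfl⟩, f.map_adj_iff.2 huw⟩

theorem HasAlmostCompleteMinor.k8Minus_isMinor {G : SimpleGraph V}
    (h : G.HasAlmostCompleteMinor 8) : K8Minus.IsMinor G := by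
  obtain ⟨B, a, b, hab, hne, hdis, hconn, hadj⟩ := h
  -- Relabelling moves the possibly missing edge to the pair 0, 1.
  obtain ⟨σ, h0, h1⟩ : ∃ σ : Equiv.Perm (Fin 8), σ 0 = a ∧ σ 1 = b := by
    let τ := Equiv.swap 0 a
    have hτ : τ b ≠ 0 := fun h => hab (by
      rw [← τ.symm_apply_eq.2 h.symm]; simp [τ])
    refine ⟨(Equiv.swap 1 (τ b)).trans τ, ?_, ?_⟩
    · rw [Equiv.trans_apply, Equiv.swap_apply_of_ne_of_ne (by decide) hτ.symm]
      simp [τ]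
    · simp [τ]
  refine ⟨B ∘ σ, fun i => hne _, fun i j hij => hdis _ _ (σ.injective.ne hij),
    fun i => hconn _, fun i j hij => ?_⟩
  simp only [K8Minus, completeGraph, deleteEdges_adj, top_adj, Set.mem_singleton_iff] at hij
  refine hadj _ _ (σ.injective.ne hij.1) fun hs => hij.2 ?_
  rw [← h0, ← h1] at hs
  simpa [Sym2.eq_iff] using hs

/-! ### Common neighbours in double-critical graphs -/

/-- For an edge `xy` of a double-critical graph, each colour of a `(k - 2)`-colouring of
`G - x - y` appears on a common neighbour of `x` and `y`. -/
theorem exists_common_neighbor {G : SimpleGraph V} {n : ℕ} (hG : ¬ G.Colorable (n + 1)) {x y : V}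
    (hxy : G.Adj x y) (c : (G.induce (({x, y} : Set V)ᶜ)).Coloring (Fin n)) (i : Fin n) :
    ∃ z, ∃ hz : z ∈ ({x, y} : Set V)ᶜ, c ⟨z, hz⟩ = i ∧ G.Adj x z ∧ G.Adj y z := by
  classical
  by_contra! hcon
  apply hG
  -- The extra colour `none` goes to `y` and to the `i`-coloured neighbours of `x`, which by
  -- assumption are not adjacent to `y`; this frees colour `i` for `x`.
  let d : V → Option (Fin n) := fun z =>
    if hz : z ∈ ({x, y} : Set V)ᶜ then
      if c ⟨z, hz⟩ = i ∧ G.Adj x z then none else some (c ⟨z, hz⟩)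
    else if z = x then some i else none
  have hd : ∀ u w, G.Adj u w → d u ≠ d w := by
    have hdx : d x = some i := by simp [d]
    have hdy : d y = none := by simp [d, hxy.ne.symm]
    have hdz : ∀ z (hz : z ∈ ({x, y} : Set V)ᶜ),
        d z = if c ⟨z, hz⟩ = i ∧ G.Adj x z then none else some (c ⟨z, hz⟩) := fun z hz => dif_pos hz
    have hx : ∀ z, G.Adj x z → d x ≠ d z := by
      intro z hz
      by_cases hzm : z ∈ ({x, y} : Set V)ᶜ
      · rw [hdx, hdz z hzm]
        split_ifs with h
        · simp
        · exact fun he => h ⟨(Option.some_injective _ he).symm, hz⟩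
      · have : z = y := by
          simp only [Set.mem_compl_iff, Set.mem_insert_iff, Set.mem_singleton_iff, not_not] at hzm
          exact hzm.resolve_left hz.ne.symm
        rw [this, hdx, hdy]
        simp
    have hy : ∀ z, G.Adj y z → d y ≠ d z := by
      intro z hz
      by_cases hzm : z ∈ ({x, y} : Set V)ᶜ
      · rw [hdy, hdz z hzm]
        split_ifs with h
        · exact absurd hz (hcon z hzm h.1 h.2)
        · simp
      · have : z = x := by
          simp only [Set.mem_compl_iff, Set.mem_insert_iff, Set.mem_singleton_iff, not_not] at hzm
          exact hzm.resolve_right hz.ne.symm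
        rw [this, hdx, hdy]
        simp
    intro u w huw
    by_cases hu : u ∈ ({x, y} : Set V)ᶜ
    · by_cases hw : w ∈ ({x, y} : Set V)ᶜ
      · have hne : c ⟨u, hu⟩ ≠ c ⟨w, hw⟩ := c.valid huw
        rw [hdz u hu, hdz w hw]
        split_ifs with h1 h2 h2
        · exact absurd (h1.1.trans h2.1.symm) hne
        · simp
        · simp
        · simpa using hne
      · simp only [Set.mem_compl_iff, Set.mem_insert_iff, Set.mem_singleton_iff, not_not] at hw
        rcases hw with rfl | rfl
        · exact (hx u huw.symm).symm
        · exact (hy u huw.symm).symm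
    · simp only [Set.mem_compl_iff, Set.mem_insert_iff, Set.mem_singleton_iff, not_not] at hu
      rcases hu with rfl | rfl
      · exact hx w huw
      · exact hy w huw
  have := (Coloring.mk d fun {u w} h => hd u w h).colorable
  simpa using this

/-- Adjacent vertices of a double-critical graph have at least `k - 2` common neighbours. -/
theorem IsDoubleCritical.le_card_commonNeighbors [Fintype V] [DecidableEq V] {G : SimpleGraph V}
    [DecidableRel G.Adj] {n : ℕ} (hG : G.IsDoubleCritical (n + 2)) {x y : V} (hxy : G.Adj x y) :
    n ≤ (G.neighborFinset x ∩ G.neighborFinset y).card := by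
  have hn : ¬ G.Colorable (n + 1) := fun h => by
    have := h.chromaticNumber_le
    rw [hG.chromaticNumber_eq] at this
    norm_cast at this
    omega
  obtain ⟨c⟩ := hG.colorable_of_adj x y hxy
  choose f hf hc hfx hfy using exists_common_neighbor hn hxy c
  have hinj : Function.Injective f := fun i j h => by
    rw [← hc i, ← hc j]
    congr 2
  calc n = (Finset.univ.image f).card := by
        rw [Finset.card_image_of_injective _ hinj, Finset.card_univ, Fintype.card_fin]
    _ ≤ _ := Finset.card_le_card fun z hz => by
        obtain ⟨i, -, rfl⟩ := Finset.mem_image.1 hz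
        simp [hfx i, hfy i]

end SimpleGraph

/-! ### The proposition -/

theorem mainTheorem7 {V : Type*} [Fintype V] [DecidableEq V]
    (G : SimpleGraph V) [DecidableRel G.Adj]
    (hG : G.IsDoubleCritical 8) (hmin : G.minDegree = 10)
    (x : V) (hx : G.degree x = 10)
    (hv : ∃ v : G.neighborSet x, (G.neighborhoodGraph x).degree v = 9) :
    SimpleGraph.K8Minus.IsMinor G := by
  classical
  obtain ⟨⟨v, hxv⟩, hv⟩ := hv
  rw [SimpleGraph.mem_neighborSet] at hxv
  have hcardx : (G.neighborFinset x).card = 10 := by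
    rw [G.card_neighborFinset_eq_degree, hx]
  have hvall : ∀ w, G.Adj x w → w ≠ v → G.Adj v w := by
    intro w hw hwv
    have huniv : (G.neighborhoodGraph x).IsUniversal ⟨v, hxv⟩ := by
      rw [← SimpleGraph.degree_eq_card_sub_one, hv, G.card_neighborSet_eq_degree, hx]
    exact huniv (w := ⟨w, hw⟩) fun h => hwv (congrArg Subtype.val h).symm
  let s : Set V := {w | G.Adj x w ∧ w ≠ v}
  have hs : s.toFinset = (G.neighborFinset x).erase v := by
    ext w
    simp [s, and_comm]
  have hscard : Fintype.card s = 9 := by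
    rw [← Set.toFinset_card, hs, Finset.card_erase_of_mem (by simpa using hxv), hcardx]
  have hH : (G.induce s).HasAlmostCompleteMinor 6 := by
    refine SimpleGraph.hasAlmostCompleteMinor_six (G.induce s) hscard fun w => ?_
    have h6 := hG.le_card_commonNeighbors w.2.1
    have hsub : (G.neighborFinset x ∩ G.neighborFinset w).erase v ⊆
        ((G.induce s).neighborFinset w).map (Function.Embedding.subtype _) := by
      intro z hz
      simp only [Finset.mem_erase, Finset.mem_inter, SimpleGraph.mem_neighborFinset] at hz
      simp only [Finset.mem_map, SimpleGraph.mem_neighborFinset]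
      exact ⟨⟨z, hz.2.1, hz.1⟩, hz.2.2, rfl⟩
    have h5 := Finset.card_le_card hsub
    rw [Finset.card_map, SimpleGraph.card_neighborFinset_eq_degree] at h5
    -- Excluding `v` costs at most one of the six common neighbours, leaving five.
    have := Finset.pred_card_le_card_erase (s := G.neighborFinset x ∩ G.neighborFinset w) (a := v)
    omega
  refine ((hH.add_one (G := G.induce (insert v s))
    (G.induceHomOfLE (Set.subset_insert v s)) (x := ⟨v, by simp⟩)
    fun w => hvall w w.2.1 w.2.2).add_one (SimpleGraph.Embedding.induce _) (x := x)
    ?_).k8Minus_isMinor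
  rintro ⟨w, rfl | hw⟩
  · exact hxv
  · exact hw.1
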